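/- Let $1\le p<\infty$ and let $r>1$ be an integer. Let $\varphi,\psi\in L^1(\mathbb R)$ be real-valued functions, with $\varphi$ bounded and $\psi$ bounded in a neighbourhood of the origin. Put $$m_\nu(\varphi,u)=\sum_{k\in\mathbb Z}\varphi(u-k)(k-u)^\nu,\qquad \widetilde m_\nu(\psi)=\int_{\mathbb R}u^\nu\psi(u)\,du,\qquad \nu=0,1,2,\dots,$$ and assume that $m_0(\varphi,u)=1$ for every $u\in\mathbb R$ and $\widetilde m_0(\psi)=1$. Suppose that (i) for every $\nu=1,\dots,r$ the moment $m_\nu(\varphi,u)=:m_\nu(\varphi)$ does not depend on $u\in\mathbb R$; (ii) $\displaystyle\sum_{\nu=0}^{i}\binom{i}{\nu}m_{i-\nu}(\varphi)\,\widetilde m_\nu(\psi)=0$ for every $i=1,\dots,r-1$, where $m_0(\varphi)=1$; ($\Theta$) $\varphi(u)=\mathcal O(|u|^{-\theta})$ as $|u|\to\infty$, for some $\theta>pr+1$; and that $\psi$ has compact support and satisfies $M_0(\psi):=\sup_{u\in\mathbb R}\sum_{k\in\mathbb Z}|\psi(u-k)|<\infty$. For $w>0$ and $f\in L^p(\mathbb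 R)$ let $$(D_w^{\varphi,\psi}f)(x)=\sum_{k\in\mathbb Z}\varphi(wx-k)\,w\int_{\mathbb R}\psi(wu-k)f(u)\,du,\qquad x\in\mathbb R,$$ and, for $\delta>0$, let $$\omega_r(f,\delta)_p=\sup_{|t|\le\delta}\Big\|\sum_{j=0}^r\binom rj(-1)^{r-j}f(\cdot+jt)\Big\|_p .$$ Then there is a constant $\Lambda_p>0$, independent of $f$ and $w$, such that for all $f\in L^p(\mathbb R)$ and all $w>0$ the integrals and the series defining $D_w^{\varphi,\psi}f$ converge absolutely (the series at every $x\in\mathbb R$), $D_w^{\varphi,\psi}f\in L^p(\mathbb R)$, and $$\|D_w^{\varphi,\psi}f-f\|_p\le\Lambda_p\,\omega_r\!\left(f,\tfrac1w\right)_p .$$ -/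

import Mathlib

open MeasureTheory Filter Topology
open scoped ENNReal

namespace Durrmeyer

noncomputable section

/-- The forward difference of order `r` and step `t`,
`Δ_t^r(f, x) = ∑_{j=0}^r (r choose j) (-1)^(r-j) f(x + j t)`. -/
def finiteDiff (r : ℕ) (t : ℝ) (f : ℝ → ℝ) (x : ℝ) : ℝ :=
  ∑ j ∈ Finset.range (r + 1), (r.choose j : ℝ) * (-1) ^ (r - j) * f (x + j * t)

/-- The `L^p` modulus of smoothness of order `r`,
`ω_r(f, δ)_p = sup_{|t| ≤ δ} ‖Δ_t^r(f, ·)‖_p`, with values in `[0, ∞]`. -/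
def modulus (r : ℕ) (p : ℝ≥0∞) (f : ℝ → ℝ) (δ : ℝ) : ℝ≥0∞ :=
  ⨆ (t : ℝ) (_ : |t| ≤ δ), eLpNorm (finiteDiff r t f) p volume

/-- The discrete algebraic moment `m_ν(φ, u) = ∑_{k ∈ ℤ} φ(u - k) (k - u)^ν`. -/
def discreteMoment (φ : ℝ → ℝ) (ν : ℕ) (u : ℝ) : ℝ :=
  ∑' k : ℤ, φ (u - k) * ((k : ℝ) - u) ^ ν

/-- The continuous algebraic moment `∫ u^ν ψ(u) du`. -/
def continuousMoment (ψ : ℝ → ℝ) (ν : ℕ) : ℝ :=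
  ∫ u : ℝ, u ^ ν * ψ u

/-- The discrete absolute moment `M_ν(ξ) = sup_u ∑_{k ∈ ℤ} |ξ(u - k)| |u - k|^ν`,
with values in `[0, ∞]`. -/
def absDiscreteMoment (ξ : ℝ → ℝ) (ν : ℝ) : ℝ≥0∞ :=
  ⨆ u : ℝ, ∑' k : ℤ, ENNReal.ofReal (|ξ (u - k)| * |u - k| ^ ν)

/-- A discrete kernel: integrable, bounded, with `m_0(φ, u) = 1` for all `u`. -/
structure IsDiscreteKernel (φ : ℝ → ℝ) : Prop where
  integrable : Integrable φ volume
  bounded : ∃ C : ℝ, ∀ u : ℝ, |φ u| ≤ C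
  moment_zero : ∀ u : ℝ, discreteMoment φ 0 u = 1

/-- A continuous kernel: integrable, bounded near the origin, with integral `1`. -/
structure IsContinuousKernel (ψ : ℝ → ℝ) : Prop where
  integrable : Integrable ψ volume
  bounded_near_zero : ∃ C : ℝ, ∀ᶠ u in 𝓝 (0 : ℝ), |ψ u| ≤ C
  moment_zero : continuousMoment ψ 0 = 1

/-- Decay condition: `ξ(u) = O(|u|^(-θ))` as `|u| → ∞`. -/
def DecayCondition (ξ : ℝ → ℝ) (θ : ℝ) : Prop :=
  ξ =O[Bornology.cobounded ℝ] fun u : ℝ => |u| ^ (-θ)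

/-- Constancy of moments: the moments `m_ν(φ, u)`, `1 ≤ ν ≤ r`, do not depend on `u`. -/
def ConstantMoments (φ : ℝ → ℝ) (r : ℕ) : Prop :=
  ∀ ν : ℕ, 1 ≤ ν → ν ≤ r → ∃ c : ℝ, ∀ u : ℝ, discreteMoment φ ν u = c

/-- Vanishing moments of Durrmeyer type: for `1 ≤ i ≤ r - 1`, the sum of
`(i choose ν) m_{i-ν}(φ) (∫ v^ν ψ(v) dv)` over `0 ≤ ν ≤ i` vanishes. The moments of `φ`
are constant in the setting of `ConstantMoments`, so quantifying over `u` is then immaterial. -/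
def VanishingMoments (φ ψ : ℝ → ℝ) (r : ℕ) : Prop :=
  ∀ i : ℕ, 1 ≤ i → i < r → ∀ u : ℝ,
    ∑ ν ∈ Finset.range (i + 1),
      (i.choose ν : ℝ) * discreteMoment φ (i - ν) u * continuousMoment ψ ν = 0

/-- The coefficient `w ∫ ψ(w u - k) f(u) du`. -/
def coeff (ψ : ℝ → ℝ) (w : ℝ) (f : ℝ → ℝ) (k : ℤ) : ℝ :=
  w * ∫ u : ℝ, ψ (w * u - k) * f u

/-- The Durrmeyer sampling operator
`(D_w f)(x) = ∑_{k ∈ ℤ} φ(w x - k) w ∫ ψ(w u - k) f(u) du`. -/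
def durrmeyerOp (φ ψ : ℝ → ℝ) (w : ℝ) (f : ℝ → ℝ) (x : ℝ) : ℝ :=
  ∑' k : ℤ, φ (w * x - k) * coeff ψ w f k

end

end Durrmeyer

/-!
The dilation `f ↦ f(· / w)` carries `D_w` to `T = D_1` and multiplies all `L^p` norms by one factor,
so it suffices to show `‖T f - f‖_p ≤ Λ ω_r(f, 1)_p`.

Because `φ(u) = O(|u|^(-θ))` and `ψ` is bounded with compact support, the kernel
`∑_k |φ(x - k)| |ψ(u - k)|` of `T` is at most `K (1 + |u - x|)^(-θ)` (`exists_kernelBound`).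
This gives the absolute convergence and, by Minkowski's integral inequality
(`eLpNorm_le_of_enorm_le_lintegral`), the boundedness of `T` on `L^p`.

The moment conditions say that `T` reproduces polynomials of degree less than `r` at the point about
which they are expanded (`hasSum_mul_coeff_one_sub_pow`). Hence for `g ∈ C^r ∩ L^p` the error
`T g - g` at `x` is `T` applied to the Taylor remainder at `x`. In integral form this remainder at
`x + y` is bounded by `|y|^r` times the average of `|g^(r)|` over the segment from `x` to `x + y`;
as `θ - r > 1`, the weight `|y|^r (1 + |y|)^(-θ)` is integrable and a second use of Minkowski's
inequality gives `‖T g - g‖_p ≤ D ‖g^(r)‖_p` (`exists_eLpNorm_durrmeyerOp_one_sub_le`).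

For continuous `f` with compact support, a combination `g` of `r`-fold Steklov averages of `f`
satisfies `‖f - g‖_p ≤ ω_r(f, 1)_p` and `‖g^(r)‖_p ≤ E ω_r(f, 1)_p`
(`eLpNorm_sub_steklovApprox_le`, `exists_eLpNorm_iteratedDeriv_steklovApprox_le`). Splitting
`T f - f = T (f - g) + (T g - g) - (f - g)` yields the estimate for such `f`. As `p < ∞` they are
dense in `L^p`, and both sides of the estimate are continuous in `f` for the `L^p` norm, so it holds
for every `f ∈ L^p`.
-/

namespace Durrmeyer

/-! ### Minkowski's integral inequality -/

theorem eLpNorm_ofReal_rpow {X : Type*} [MeasurableSpace X] {p : ℝ} (hp : 0 < p) (μ : Measure X)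
    (g : X → ℝ) : eLpNorm g (ENNReal.ofReal p) μ ^ p = ∫⁻ x, ‖g x‖ₑ ^ p ∂μ := by
  rw [eLpNorm_eq_lintegral_rpow_enorm_toReal (by simpa using hp) ENNReal.ofReal_ne_top,
    ENNReal.toReal_ofReal hp.le, ← ENNReal.rpow_mul]
  simp [hp.ne']

/-- Minkowski's integral inequality, for a function dominated by an average of functions whose
`L^p` norms are at most `M`. -/
theorem eLpNorm_le_of_enorm_le_lintegral {X Y : Type*} [MeasurableSpace X] [MeasurableSpace Y]
    {μ : Measure X} [SFinite μ] {ν : Measure Y} [IsFiniteMeasure ν] {p : ℝ} (hp : 1 ≤ p)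
    {h : X → ℝ} {F : X → Y → ℝ} {M : ℝ≥0∞}
    (hF : AEStronglyMeasurable (Function.uncurry F) (μ.prod ν))
    (hh : ∀ x, ‖h x‖ₑ ≤ ∫⁻ y, ‖F x y‖ₑ ∂ν)
    (hM : ∀ᵐ y ∂ν, eLpNorm (fun x => F x y) (ENNReal.ofReal p) μ ≤ M) :
    eLpNorm h (ENNReal.ofReal p) μ ≤ ν Set.univ * M := by
  have hp0 : 0 < p := by linarith
  have htr : (ENNReal.ofReal p).toReal = p := ENNReal.toReal_ofReal hp0.le
  rw [← ENNReal.rpow_le_rpow_iff hp0, eLpNorm_ofReal_rpow hp0,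
    ENNReal.mul_rpow_of_nonneg _ _ hp0.le]
  -- Hölder's inequality against the constant `1` in the variable `y`.
  have hsec : ∀ᵐ x ∂μ, ‖h x‖ₑ ^ p ≤ (∫⁻ y, ‖F x y‖ₑ ^ p ∂ν) * ν Set.univ ^ (p - 1) := by
    filter_upwards [hF.prodMk_left] with x hx
    have h1 := eLpNorm_le_eLpNorm_mul_rpow_measure_univ (p := 1) (q := ENNReal.ofReal p)
      (by simpa using hp) (show AEStronglyMeasurable (F x) ν from hx)
    rw [eLpNorm_one_eq_lintegral_enorm, htr] at h1
    calc ‖h x‖ₑ ^ p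
        ≤ (eLpNorm (F x) (ENNReal.ofReal p) ν
            * ν Set.univ ^ (1 / (1 : ℝ≥0∞).toReal - 1 / p)) ^ p := by
          gcongr; exact (hh x).trans h1
      _ = _ := by
          rw [ENNReal.mul_rpow_of_nonneg _ _ hp0.le, eLpNorm_ofReal_rpow hp0, ← ENNReal.rpow_mul]
          congr 2
          simp only [ENNReal.toReal_one]
          field_simp
  calc ∫⁻ x, ‖h x‖ₑ ^ p ∂μ
      ≤ ∫⁻ x, (∫⁻ y, ‖F x y‖ₑ ^ p ∂ν) * ν Set.univ ^ (p - 1) ∂μ := lintegral_mono_ae hsec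
    _ = (∫⁻ x, ∫⁻ y, ‖F x y‖ₑ ^ p ∂ν ∂μ) * ν Set.univ ^ (p - 1) :=
        lintegral_mul_const' _ _
          (ENNReal.rpow_ne_top_of_nonneg (by linarith) (measure_ne_top _ _))
    _ = (∫⁻ y, ∫⁻ x, ‖F x y‖ₑ ^ p ∂μ ∂ν) * ν Set.univ ^ (p - 1) := by
        rw [lintegral_lintegral_swap]
        exact hF.enorm.pow_const p
    _ ≤ (∫⁻ _, M ^ p ∂ν) * ν Set.univ ^ (p - 1) := by
        gcongr ?_ * _
        refine lintegral_mono_ae ?_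
        filter_upwards [hM] with y hy
        rw [← eLpNorm_ofReal_rpow hp0 μ (fun x => F x y)]
        gcongr
    _ = ν Set.univ ^ p * M ^ p := by
        rw [lintegral_const, mul_assoc, mul_comm]
        congr 1
        by_cases h0 : ν Set.univ = 0
        · simp [h0, hp0]
        conv_lhs => rw [← ENNReal.rpow_one (ν Set.univ), ← ENNReal.rpow_mul, one_mul]
        rw [← ENNReal.rpow_add _ _ h0 (measure_ne_top _ _)]
        congr 1; ring

/-! ### Steklov averages -/

/-- The law of a sum of `n` independent random variables, uniform on `(0, 1]`; its density is the
cardinal B-spline of order `n`. -/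
noncomputable def steklovMeasure : ℕ → Measure ℝ
  | 0 => Measure.dirac 0
  | n + 1 => (volume.restrict (Set.Ioc 0 1)).conv (steklovMeasure n)

instance isProbabilityMeasure_steklovMeasure (n : ℕ) : IsProbabilityMeasure (steklovMeasure n) := by
  induction n with
  | zero => unfold steklovMeasure; infer_instance
  | succ n ih =>
    have : IsProbabilityMeasure ((volume : Measure ℝ).restrict (Set.Ioc 0 1)) :=
      ⟨by simp⟩
    unfold steklovMeasure
    infer_instance

theorem ae_steklovMeasure_mem_Icc (n : ℕ) :
    ∀ᵐ s ∂steklovMeasure n, s ∈ Set.Icc (0 : ℝ) n := by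
  induction n with
  | zero => simp [steklovMeasure, ae_dirac_eq]
  | succ n ih =>
    unfold steklovMeasure Measure.conv
    rw [ae_map_iff (p := (· ∈ Set.Icc (0 : ℝ) ((n + 1 : ℕ) : ℝ))) (by fun_prop) measurableSet_Icc]
    have h1 : ∀ᵐ a : ℝ ∂volume.restrict (Set.Ioc 0 1), a ∈ Set.Ioc (0 : ℝ) 1 :=
      ae_restrict_mem measurableSet_Ioc
    filter_upwards [Measure.quasiMeasurePreserving_fst.ae h1,
      Measure.quasiMeasurePreserving_snd.ae ih] with z hz1 hz2
    push_cast
    exact ⟨by linarith [hz1.1, hz2.1], by linarith [hz1.2, hz2.2]⟩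

/-- The `n`-fold Steklov average with step `h`,
`∫_{[0,1]^n} f(x + h (t_1 + ⋯ + t_n)) dt`, written as one integral against the law of
`t_1 + ⋯ + t_n`. -/
noncomputable def steklov (n : ℕ) (h : ℝ) (f : ℝ → ℝ) (x : ℝ) : ℝ :=
  ∫ s, f (x + h * s) ∂steklovMeasure n

theorem integrable_comp_affine {f : ℝ → ℝ} (hf : Continuous f) {C : ℝ} (hC : ∀ x, |f x| ≤ C)
    (μ : Measure ℝ) [IsFiniteMeasure μ] (x h : ℝ) : Integrable (fun s => f (x + h * s)) μ :=
  Integrable.of_bound (by fun_prop) C (.of_forall fun s => hC _)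

theorem steklov_zero (h : ℝ) (f : ℝ → ℝ) : steklov 0 h f = f := by
  ext x; simp [steklov, steklovMeasure]

theorem steklov_succ (n : ℕ) (h : ℝ) {f : ℝ → ℝ} (hf : Continuous f) {C : ℝ}
    (hC : ∀ x, |f x| ≤ C) (x : ℝ) :
    steklov (n + 1) h f x = ∫ t in (0 : ℝ)..1, steklov n h f (x + h * t) := by
  rw [intervalIntegral.integral_of_le zero_le_one]
  unfold steklov
  rw [steklovMeasure, integral_conv]
  · simp only [mul_add, add_assoc]
  · have : IsProbabilityMeasure ((volume : Measure ℝ).restrict (Set.Ioc 0 1)) := ⟨by simp⟩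
    exact integrable_comp_affine hf hC _ x h

theorem hasDerivAt_integral_add_mul {g : ℝ → ℝ} (hg : Continuous g) {h : ℝ} (hh : h ≠ 0) (x : ℝ) :
    HasDerivAt (fun x => ∫ t in (0 : ℝ)..1, g (x + h * t)) (h⁻¹ * fwdDiff h g x) x := by
  have heq : (fun x => ∫ t in (0 : ℝ)..1, g (x + h * t)) =
      fun x => h⁻¹ * ((∫ u in (0 : ℝ)..(x + h), g u) - ∫ u in (0 : ℝ)..x, g u) := by
    ext x
    rw [intervalIntegral.integral_comp_add_mul _ hh, smul_eq_mul,
      intervalIntegral.integral_interval_sub_left (hg.intervalIntegrable _ _)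
        (hg.intervalIntegrable _ _)]
    simp
  rw [heq]
  refine HasDerivAt.const_mul _ (HasDerivAt.sub ?_ ?_)
  · exact HasDerivAt.comp_add_const x h
      (intervalIntegral.integral_hasDerivAt_right (hg.intervalIntegrable _ _)
        (hg.stronglyMeasurableAtFilter _ _) hg.continuousAt)
  · exact intervalIntegral.integral_hasDerivAt_right (hg.intervalIntegrable _ _)
        (hg.stronglyMeasurableAtFilter _ _) hg.continuousAt

/-- Each average gains one derivative, and differentiating it gives a divided difference, so the
`n`-th derivative of the `n`-fold average is a divided difference of order `n`. -/
theorem contDiff_steklov_and_iteratedDeriv {h : ℝ} (hh : h ≠ 0) {f : ℝ → ℝ} (hf : Continuous f)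
    {C : ℝ} (hC : ∀ x, |f x| ≤ C) (n : ℕ) :
    ContDiff ℝ n (steklov n h f) ∧
      iteratedDeriv n (steklov n h f) = fun x => h⁻¹ ^ n * (fwdDiff h)^[n] f x := by
  induction n with
  | zero => simpa [steklov_zero, contDiff_zero] using hf
  | succ n ih =>
    have hs : steklov (n + 1) h f = fun x => ∫ t in (0 : ℝ)..1, steklov n h f (x + h * t) :=
      funext (steklov_succ n h hf hC)
    have hd := fun x => hasDerivAt_integral_add_mul ih.1.continuous hh x
    rw [← hs] at hd
    have hderiv : deriv (steklov (n + 1) h f) = fun x => h⁻¹ * fwdDiff h (steklov n h f) x :=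
      funext fun x => (hd x).deriv
    have hshift : ContDiff ℝ n fun x => steklov n h f (x + h) := ih.1.comp (by fun_prop)
    constructor
    · push_cast
      rw [contDiff_succ_iff_deriv]
      refine ⟨fun x => (hd x).differentiableAt, by simp, ?_⟩
      rw [hderiv]
      exact contDiff_const.mul (hshift.sub ih.1)
    · rw [iteratedDeriv_succ', hderiv]
      ext x
      rw [iteratedDeriv_const_mul_field]
      change _ * iteratedDeriv n (fun z => steklov n h f (z + h) - steklov n h f z) x = _
      rw [iteratedDeriv_fun_sub hshift.contDiffAt ih.1.contDiffAt, iteratedDeriv_comp_add_const,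
        ih.2, Function.iterate_succ_apply']
      change _ = _ * ((fwdDiff h)^[n] f (x + h) - (fwdDiff h)^[n] f x)
      ring

theorem fwdDiff_iterate_eq_finiteDiff (r : ℕ) (h : ℝ) (f : ℝ → ℝ) (x : ℝ) :
    (fwdDiff h)^[r] f x = finiteDiff r h f x := by
  rw [fwdDiff_iter_eq_sum_shift, finiteDiff]
  refine Finset.sum_congr rfl fun j _ => ?_
  simp only [zsmul_eq_mul, nsmul_eq_mul]
  push_cast
  ring

/-! ### Domination of the operator by a convolution -/

/-- Boundedness near the origin and decay at infinity combine into one global bound. -/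
theorem exists_abs_le_one_add_abs_rpow {φ : ℝ → ℝ} {θ : ℝ} (hθ : 0 < θ)
    (hb : ∃ C : ℝ, ∀ u, |φ u| ≤ C) (hd : DecayCondition φ θ) :
    ∃ C : ℝ, 0 ≤ C ∧ ∀ u, |φ u| ≤ C * (1 + |u|) ^ (-θ) := by
  obtain ⟨C₀, hC₀⟩ := hb
  obtain ⟨c, hc⟩ := hd.bound
  obtain ⟨R, -, hR⟩ := hasBasis_cobounded_norm.eventually_iff.mp hc
  have hC₀0 : 0 ≤ C₀ := (abs_nonneg _).trans (hC₀ 0)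
  set R' := max R 1 with hR'
  have hR'1 : 1 ≤ R' := le_max_right _ _
  refine ⟨|c| * 2 ^ θ + C₀ * (1 + R') ^ θ, by positivity, fun u => ?_⟩
  have hu : 0 ≤ |u| := abs_nonneg u
  rcases le_total R' |u| with h | h
  · have h1 : |φ u| ≤ c * |u| ^ (-θ) := by
      have := hR (show R ≤ ‖u‖ from (le_max_left _ _).trans h)
      rwa [Real.norm_eq_abs, Real.norm_eq_abs, abs_of_nonneg (Real.rpow_nonneg hu _)] at this
    have hu1 : 1 ≤ |u| := hR'1.trans h
    have h2 : |u| ^ (-θ) ≤ ((1 + |u|) / 2) ^ (-θ) :=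
      Real.rpow_le_rpow_of_nonpos (by positivity) (by linarith) (by linarith)
    have h3 : ((1 + |u|) / 2) ^ (-θ) = 2 ^ θ * (1 + |u|) ^ (-θ) := by
      rw [Real.div_rpow (by positivity) (by norm_num), Real.rpow_neg (by norm_num : (0:ℝ) ≤ 2)]
      field_simp
    have h4 : 0 ≤ C₀ * (1 + R') ^ θ * (1 + |u|) ^ (-θ) := by positivity
    calc |φ u| ≤ c * |u| ^ (-θ) := h1
      _ ≤ |c| * (2 ^ θ * (1 + |u|) ^ (-θ)) := by
          rw [← h3]
          gcongr
          exact le_abs_self c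
      _ ≤ _ := by linarith
  · have h2 : (1 + R') ^ (-θ) ≤ (1 + |u|) ^ (-θ) :=
      Real.rpow_le_rpow_of_nonpos (by positivity) (by linarith) (by linarith)
    have h3 : (1 + R') ^ θ * (1 + R') ^ (-θ) = 1 := by
      rw [← Real.rpow_add (by positivity)]; simp
    have h4 : 0 ≤ |c| * 2 ^ θ * (1 + |u|) ^ (-θ) := by positivity
    calc |φ u| ≤ C₀ * ((1 + R') ^ θ * (1 + R') ^ (-θ)) := by rw [h3, mul_one]; exact hC₀ u
      _ ≤ C₀ * ((1 + R') ^ θ * (1 + |u|) ^ (-θ)) := by gcongr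
      _ ≤ _ := by linarith

theorem tsum_enorm_le_absDiscreteMoment_zero (ψ : ℝ → ℝ) (u : ℝ) :
    ∑' k : ℤ, ‖ψ (u - k)‖ₑ ≤ absDiscreteMoment ψ 0 := by
  have h : ∑' k : ℤ, ‖ψ (u - k)‖ₑ = ∑' k : ℤ, ENNReal.ofReal (|ψ (u - k)| * |u - k| ^ (0 : ℝ)) := by
    simp [Real.enorm_eq_ofReal_abs]
  rw [h]
  exact le_iSup (fun u : ℝ => ∑' k : ℤ, ENNReal.ofReal (|ψ (u - k)| * |u - k| ^ (0 : ℝ))) u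

theorem abs_le_of_absDiscreteMoment_zero_lt_top {ψ : ℝ → ℝ} (h : absDiscreteMoment ψ 0 < ∞)
    (u : ℝ) : |ψ u| ≤ (absDiscreteMoment ψ 0).toReal := by
  have h1 : ‖ψ u‖ₑ ≤ absDiscreteMoment ψ 0 := by
    refine le_trans ?_ (tsum_enorm_le_absDiscreteMoment_zero ψ u)
    simpa using ENNReal.le_tsum (f := fun k : ℤ => ‖ψ (u - k)‖ₑ) 0
  simpa using ENNReal.toReal_mono h.ne h1

/-- The absolute kernel `∑_k |φ(x - k)| |ψ(u - k)|` of the operator with `w = 1` is dominated by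
the convolution kernel `K (1 + |u - x|)^(-θ)`. -/
def KernelBound (φ ψ : ℝ → ℝ) (K θ : ℝ) : Prop :=
  ∀ x u : ℝ, ∑' k : ℤ, ‖φ (x - k)‖ₑ * ‖ψ (u - k)‖ₑ ≤ ENNReal.ofReal (K * (1 + |u - x|) ^ (-θ))

/-- Since `ψ(u - k)` vanishes unless `k` is near `u`, the decay of `φ(x - k)` is a decay in
`u - x`. -/
theorem exists_kernelBound {φ ψ : ℝ → ℝ} {C θ : ℝ} (hC : 0 ≤ C) (hθ : 0 < θ)
    (hφ : ∀ u, |φ u| ≤ C * (1 + |u|) ^ (-θ)) (hs : HasCompactSupport ψ)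
    (hm : absDiscreteMoment ψ 0 < ∞) :
    ∃ K : ℝ, 0 ≤ K ∧ KernelBound φ ψ K θ := by
  obtain ⟨A, hA0, hA⟩ : ∃ A : ℝ, 0 ≤ A ∧ ∀ u, ψ u ≠ 0 → |u| ≤ A := by
    obtain ⟨A, hA⟩ := hs.isCompact.isBounded.exists_norm_le
    exact ⟨max A 0, le_max_right _ _, fun u hu =>
      (hA u (subset_tsupport _ hu)).trans (le_max_left _ _)⟩
  set M := (absDiscreteMoment ψ 0).toReal
  refine ⟨C * (1 + A) ^ θ * M, by positivity, fun x u => ?_⟩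
  have hterm : ∀ k : ℤ, ‖φ (x - k)‖ₑ * ‖ψ (u - k)‖ₑ ≤
      ENNReal.ofReal (C * (1 + A) ^ θ * (1 + |u - x|) ^ (-θ)) * ‖ψ (u - k)‖ₑ := by
    intro k
    by_cases h0 : ψ (u - k) = 0
    · simp [h0]
    have hk := hA _ h0
    have h1 : (1 + |u - x|) / (1 + A) ≤ 1 + |x - k| := by
      rw [div_le_iff₀ (by positivity)]
      have h2 : |u - x| ≤ |u - k| + |x - k| := by
        have := abs_sub (u - k) (x - k)
        simpa using this
      nlinarith [abs_nonneg (x - k)]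
    have h3 : (1 + |x - k|) ^ (-θ) ≤ (1 + A) ^ θ * (1 + |u - x|) ^ (-θ) := by
      refine (Real.rpow_le_rpow_of_nonpos (by positivity) h1 (by linarith)).trans_eq ?_
      rw [Real.div_rpow (by positivity) (by positivity), Real.rpow_neg (by positivity : 0 ≤ 1 + A)]
      field_simp
    gcongr
    rw [Real.enorm_eq_ofReal_abs]
    refine ENNReal.ofReal_le_ofReal ((hφ _).trans ?_)
    rw [mul_assoc]
    gcongr
  calc ∑' k : ℤ, ‖φ (x - k)‖ₑ * ‖ψ (u - k)‖ₑ
      ≤ ∑' k : ℤ, ENNReal.ofReal (C * (1 + A) ^ θ * (1 + |u - x|) ^ (-θ)) * ‖ψ (u - k)‖ₑ :=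
        ENNReal.tsum_le_tsum hterm
    _ ≤ ENNReal.ofReal (C * (1 + A) ^ θ * (1 + |u - x|) ^ (-θ)) * absDiscreteMoment ψ 0 := by
        rw [ENNReal.tsum_mul_left]
        gcongr
        exact tsum_enorm_le_absDiscreteMoment_zero ψ u
    _ = _ := by
        rw [← ENNReal.ofReal_toReal hm.ne, ← ENNReal.ofReal_mul (by positivity)]
        congr 1
        ring

theorem coeff_one (ψ f : ℝ → ℝ) (k : ℤ) : coeff ψ 1 f k = ∫ u, ψ (u - k) * f u := by
  simp [coeff]

theorem durrmeyerOp_one (φ ψ f : ℝ → ℝ) (x : ℝ) :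
    durrmeyerOp φ ψ 1 f x = ∑' k : ℤ, φ (x - k) * coeff ψ 1 f k := by
  simp [durrmeyerOp]

theorem integrable_translate_mul {ψ f : ℝ → ℝ} (hψ : AEStronglyMeasurable ψ volume)
    {B : ℝ} (hB : ∀ u, |ψ u| ≤ B) (hs : HasCompactSupport ψ) (hf : LocallyIntegrable f volume)
    (a : ℝ) : Integrable (fun u => ψ (u - a) * f u) volume := by
  have hs' : HasCompactSupport fun u => ψ (u - a) :=
    hs.comp_homeomorph (Homeomorph.subRight a)
  have hmeas : AEStronglyMeasurable (fun u => ψ (u - a)) volume :=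
    hψ.comp_measurePreserving (measurePreserving_sub_right volume a)
  have h1 : IntegrableOn (fun u => ψ (u - a) * f u) (tsupport fun u => ψ (u - a)) volume :=
    (hf.integrableOn_isCompact hs').bdd_mul hmeas.restrict
      (.of_forall fun u => hB (u - a))
  rw [integrableOn_iff_integrable_of_support_subset] at h1
  · exact h1
  · exact (Function.support_mul_subset_left _ _).trans (subset_tsupport _)

/-- The operator is dominated, at every point and with absolute values inside the series, by
convolution with the integrable kernel `K (1 + |y|)^(-θ)`. -/
theorem tsum_enorm_mul_coeff_le {φ ψ : ℝ → ℝ} {K θ : ℝ}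
    (hψ : AEStronglyMeasurable ψ volume)
    (hK : KernelBound φ ψ K θ)
    {h : ℝ → ℝ} (hh : AEStronglyMeasurable h volume) (x : ℝ) :
    ∑' k : ℤ, ‖φ (x - k) * coeff ψ 1 h k‖ₑ ≤
      ∫⁻ y, ENNReal.ofReal (K * (1 + |y|) ^ (-θ)) * ‖h (x + y)‖ₑ := by
  have hmeas : ∀ k : ℤ, AEStronglyMeasurable (fun u => ψ (u - k)) volume := fun k =>
    hψ.comp_measurePreserving (measurePreserving_sub_right volume (k : ℝ))
  calc ∑' k : ℤ, ‖φ (x - k) * coeff ψ 1 h k‖ₑ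
      ≤ ∑' k : ℤ, ∫⁻ u, ‖φ (x - k)‖ₑ * ‖ψ (u - k)‖ₑ * ‖h u‖ₑ := by
        refine ENNReal.tsum_le_tsum fun k => ?_
        rw [enorm_mul, coeff_one]
        simp_rw [mul_assoc]
        rw [lintegral_const_mul' _ _ enorm_ne_top]
        gcongr
        refine (enorm_integral_le_lintegral_enorm _).trans_eq ?_
        simp_rw [enorm_mul]
    _ = ∫⁻ u, (∑' k : ℤ, ‖φ (x - k)‖ₑ * ‖ψ (u - k)‖ₑ) * ‖h u‖ₑ := by
        simp_rw [← ENNReal.tsum_mul_right]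
        exact (lintegral_tsum fun k => ((hmeas k).enorm.const_mul _).mul hh.enorm).symm
    _ ≤ ∫⁻ u, ENNReal.ofReal (K * (1 + |u - x|) ^ (-θ)) * ‖h u‖ₑ := by
        gcongr with u
        exact hK x u
    _ = ∫⁻ y, ENNReal.ofReal (K * (1 + |y|) ^ (-θ)) * ‖h (x + y)‖ₑ := by
        rw [← lintegral_add_left_eq_self _ x]
        simp

theorem lintegral_one_add_abs_rpow_lt_top (K : ℝ) {s : ℝ} (hs : 1 < s) :
    ∫⁻ y : ℝ, ENNReal.ofReal (K * (1 + |y|) ^ (-s)) < ∞ := by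
  have h : Integrable (fun y : ℝ => K * (1 + ‖y‖) ^ (-s)) volume :=
    (integrable_one_add_norm (by simpa using hs)).const_mul K
  exact h.lintegral_lt_top

/-- Convergence at every `x`, not only almost every `x`: the dominating kernel is both bounded and
integrable, so that `a ≤ 1 + a ^ p` is enough. -/
theorem summable_mul_coeff {φ ψ : ℝ → ℝ} {K θ p : ℝ} (hp : 1 ≤ p) (hθ : 1 < θ)
    (hψ : AEStronglyMeasurable ψ volume) (hK0 : 0 ≤ K)
    (hK : KernelBound φ ψ K θ)
    {f : ℝ → ℝ} (hf : MemLp f (ENNReal.ofReal p) volume) (x : ℝ) :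
    Summable fun k : ℤ => φ (x - k) * coeff ψ 1 f k := by
  have hp0 : 0 < p := by linarith
  refine Summable.of_norm (tsum_enorm_ne_top_iff_summable_norm.mp
    ((tsum_enorm_mul_coeff_le hψ hK hf.1 x).trans_lt ?_).ne)
  have hpt : ∀ y : ℝ, ENNReal.ofReal (K * (1 + |y|) ^ (-θ)) * ‖f (x + y)‖ₑ ≤
      ENNReal.ofReal (K * (1 + |y|) ^ (-θ)) + ENNReal.ofReal K * ‖f (x + y)‖ₑ ^ p := by
    intro y
    have hle : ENNReal.ofReal (K * (1 + |y|) ^ (-θ)) ≤ ENNReal.ofReal K := by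
      refine ENNReal.ofReal_le_ofReal (mul_le_of_le_one_right hK0 ?_)
      exact Real.rpow_le_one_of_one_le_of_nonpos (by linarith [abs_nonneg y]) (by linarith)
    -- `a ≤ 1` is absorbed by the first summand, and `a ≥ 1` gives `a ≤ a ^ p`.
    rcases le_total ‖f (x + y)‖ₑ 1 with h1 | h1
    · exact (mul_le_of_le_one_right' h1).trans le_self_add
    · refine le_trans ?_ le_add_self
      gcongr
      simpa using ENNReal.rpow_le_rpow_of_exponent_le h1 hp
  refine (lintegral_mono hpt).trans_lt ?_
  rw [lintegral_add_left (by fun_prop), lintegral_const_mul' _ _ ENNReal.ofReal_ne_top,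
    lintegral_add_left_eq_self (fun y => ‖f y‖ₑ ^ p) x, ← eLpNorm_ofReal_rpow hp0]
  exact ENNReal.add_lt_top.mpr ⟨lintegral_one_add_abs_rpow_lt_top K hθ,
    ENNReal.mul_lt_top ENNReal.ofReal_lt_top
      (ENNReal.rpow_lt_top_of_nonneg hp0.le hf.2.ne)⟩

theorem aestronglyMeasurable_durrmeyerOp_one {φ : ℝ → ℝ} (hφ : AEStronglyMeasurable φ volume)
    (ψ f : ℝ → ℝ) : AEStronglyMeasurable (durrmeyerOp φ ψ 1 f) volume := by
  have h : durrmeyerOp φ ψ 1 f = fun x => ∑' k : ℤ, φ (x - k) * coeff ψ 1 f k :=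
    funext (durrmeyerOp_one φ ψ f)
  rw [h]
  have hm (k : ℤ) : AEStronglyMeasurable (fun x => φ (x - k) * coeff ψ 1 f k) volume :=
    (hφ.comp_measurePreserving (measurePreserving_sub_right volume (k : ℝ))).mul_const _
  fun_prop

theorem eLpNorm_durrmeyerOp_one_le {φ ψ : ℝ → ℝ} {K θ p : ℝ} (hp : 1 ≤ p) (hθ : 1 < θ)
    (hψ : AEStronglyMeasurable ψ volume)
    (hK : KernelBound φ ψ K θ)
    {f : ℝ → ℝ} (hf : AEStronglyMeasurable f volume) :
    eLpNorm (durrmeyerOp φ ψ 1 f) (ENNReal.ofReal p) volume ≤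
      (∫⁻ y : ℝ, ENNReal.ofReal (K * (1 + |y|) ^ (-θ))) *
        eLpNorm f (ENNReal.ofReal p) volume := by
  set κ : ℝ → ℝ≥0∞ := fun y => ENNReal.ofReal (K * (1 + |y|) ^ (-θ)) with hκ
  have hκm : Measurable κ := by fun_prop
  have hfin : IsFiniteMeasure (volume.withDensity κ) :=
    isFiniteMeasure_withDensity (lintegral_one_add_abs_rpow_lt_top K hθ).ne
  have hmain := eLpNorm_le_of_enorm_le_lintegral (μ := volume) (ν := volume.withDensity κ) hp
    (h := durrmeyerOp φ ψ 1 f) (F := fun x y => f (y + x))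
    (M := eLpNorm f (ENNReal.ofReal p) volume)
    (hf.comp_quasiMeasurePreserving (quasiMeasurePreserving_add_swap volume _)) ?_ ?_
  · simpa using hmain
  · intro x
    rw [durrmeyerOp_one, lintegral_withDensity_eq_lintegral_mul_non_measurable _ hκm
      (.of_forall fun y => ENNReal.ofReal_lt_top)]
    refine enorm_tsum_le_tsum_enorm.trans ((tsum_enorm_mul_coeff_le hψ hK hf x).trans_eq ?_)
    simp [hκ, add_comm]
  · exact .of_forall fun y => (eLpNorm_comp_measurePreserving hf
      (measurePreserving_add_left volume y)).le

/-! ### Polynomial reproduction and smooth functions -/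

theorem summable_one_add_abs_sub_rpow (x : ℝ) {s : ℝ} (hs : 1 < s) :
    Summable fun k : ℤ => (1 + |x - k|) ^ (-s) := by
  have hsum := (Real.summable_abs_int_rpow hs).mul_left ((1 + |x|) ^ s)
  refine hsum.of_norm_bounded_eventually ?_
  -- At `k = 0` the comparison fails, since `0 ^ (-s)` is `0` in `ℝ`.
  have hne : ∀ᶠ k : ℤ in cofinite, k ≠ 0 :=
    (Set.finite_singleton (0 : ℤ)).eventually_cofinite_notMem
  filter_upwards [hne] with k hk
  have hk' : 0 < |(k : ℝ)| := by positivity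
  rw [Real.norm_eq_abs, abs_of_nonneg (by positivity)]
  have h1 : |(k : ℝ)| / (1 + |x|) ≤ 1 + |x - k| := by
    rw [div_le_iff₀ (by positivity)]
    have h2 : |(k : ℝ)| ≤ |x| + |x - k| := by
      simpa using abs_sub x (x - k)
    nlinarith [abs_nonneg x, abs_nonneg (x - k), mul_nonneg (abs_nonneg x) (abs_nonneg (x - k))]
  refine (Real.rpow_le_rpow_of_nonpos (by positivity) h1 (by linarith)).trans_eq ?_
  rw [Real.div_rpow hk'.le (by positivity), Real.rpow_neg (by positivity : 0 ≤ 1 + |x|)]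
  field_simp

theorem summable_mul_int_sub_pow {φ : ℝ → ℝ} {C θ : ℝ}
    (hφ : ∀ u, |φ u| ≤ C * (1 + |u|) ^ (-θ)) {j : ℕ} (hj : (j : ℝ) + 1 < θ) (x : ℝ) :
    Summable fun k : ℤ => φ (x - k) * ((k : ℝ) - x) ^ j := by
  have hsum := (summable_one_add_abs_sub_rpow x (s := θ - j) (by linarith)).mul_left C
  refine Summable.of_norm_bounded hsum fun k => ?_
  have h0 : 0 < 1 + |x - k| := by positivity
  have h1 : |(k : ℝ) - x| ^ j ≤ (1 + |x - k|) ^ j := by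
    rw [abs_sub_comm]
    gcongr
    linarith
  rw [norm_mul, norm_pow, Real.norm_eq_abs, Real.norm_eq_abs,
    show -(θ - j) = -θ + j by ring, Real.rpow_add h0, Real.rpow_natCast, ← mul_assoc]
  exact mul_le_mul (hφ _) h1 (by positivity) ((abs_nonneg _).trans (hφ _))

/-- Binomial expansion of `(v + (k - x))^i` under the integral. -/
theorem coeff_one_sub_pow {ψ : ℝ → ℝ} (hψ : AEStronglyMeasurable ψ volume)
    {B : ℝ} (hB : ∀ u, |ψ u| ≤ B) (hs : HasCompactSupport ψ) (x : ℝ) (i : ℕ) (k : ℤ) :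
    coeff ψ 1 (fun u => (u - x) ^ i) k =
      ∑ ν ∈ Finset.range (i + 1),
        (i.choose ν : ℝ) * continuousMoment ψ ν * ((k : ℝ) - x) ^ (i - ν) := by
  have hint : ∀ ν : ℕ, Integrable (fun v => v ^ ν * ψ v) volume := fun ν => by
    have := integrable_translate_mul hψ hB hs
      (continuous_pow ν : Continuous fun v : ℝ => v ^ ν).locallyIntegrable 0
    simpa [mul_comm] using this
  rw [coeff_one, ← integral_add_right_eq_self _ (k : ℝ)]
  have hexp : (fun v : ℝ => ψ (v + k - k) * (v + k - x) ^ i) = fun v =>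
      ∑ ν ∈ Finset.range (i + 1), ((i.choose ν : ℝ) * ((k : ℝ) - x) ^ (i - ν)) * (v ^ ν * ψ v) := by
    ext v
    rw [add_sub_cancel_right, add_sub_assoc, add_pow, Finset.mul_sum]
    exact Finset.sum_congr rfl fun ν _ => by ring
  rw [hexp, integral_finsetSum _ fun ν _ => (hint ν).const_mul _]
  refine Finset.sum_congr rfl fun ν _ => ?_
  rw [integral_const_mul, continuousMoment]
  ring

/-- Reproduction of polynomials of degree less than `r`: applied to `(· - x)^i` and evaluated at
`x`, the operator gives the Durrmeyer type sum of moments, which is `1` for `i = 0` and vanishes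
for `1 ≤ i < r`. -/
theorem hasSum_mul_coeff_one_sub_pow {φ ψ : ℝ → ℝ} {r : ℕ} {C θ : ℝ} (hθ : (r : ℝ) + 1 < θ)
    (hφ0 : ∀ u, discreteMoment φ 0 u = 1) (hφ : ∀ u, |φ u| ≤ C * (1 + |u|) ^ (-θ))
    (hψ : AEStronglyMeasurable ψ volume)
    {B : ℝ} (hB : ∀ u, |ψ u| ≤ B) (hs : HasCompactSupport ψ) (hψ0 : continuousMoment ψ 0 = 1)
    (hv : VanishingMoments φ ψ r) (x : ℝ) {i : ℕ} (hi : i < r) :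
    HasSum (fun k : ℤ => φ (x - k) * coeff ψ 1 (fun u => (u - x) ^ i) k)
      (if i = 0 then 1 else 0) := by
  have hsum : HasSum (fun k : ℤ => φ (x - k) * coeff ψ 1 (fun u => (u - x) ^ i) k)
      (∑ ν ∈ Finset.range (i + 1),
        (i.choose ν : ℝ) * continuousMoment ψ ν * discreteMoment φ (i - ν) x) := by
    have hterm : (fun k : ℤ => φ (x - k) * coeff ψ 1 (fun u => (u - x) ^ i) k) = fun k : ℤ =>
        ∑ ν ∈ Finset.range (i + 1), (i.choose ν : ℝ) * continuousMoment ψ ν *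
          (φ (x - k) * ((k : ℝ) - x) ^ (i - ν)) := by
      ext k
      rw [coeff_one_sub_pow hψ hB hs, Finset.mul_sum]
      exact Finset.sum_congr rfl fun ν _ => by ring
    rw [hterm]
    refine hasSum_sum fun ν _ => HasSum.mul_left _ (Summable.hasSum ?_)
    refine summable_mul_int_sub_pow hφ ?_ x
    have : ((i - ν : ℕ) : ℝ) ≤ r := by exact_mod_cast (Nat.sub_le _ _).trans hi.le
    linarith
  convert hsum using 1
  split_ifs with h0
  · subst h0
    simp [hφ0, hψ0]
  · rw [← hv i (Nat.one_le_iff_ne_zero.mpr h0) hi x]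
    exact Finset.sum_congr rfl fun ν _ => by ring

/-- Keeping the remainder as an average of `iteratedDeriv (n + 1) g` along the segment from `x` to
`x + y`, and not as a supremum, makes Minkowski's inequality applicable to it. -/
theorem enorm_taylor_remainder_le {n : ℕ} {g : ℝ → ℝ} (hg : ContDiff ℝ (n + 1 : ℕ) g) (x y : ℝ) :
    ‖g (x + y) - ∑ i ∈ Finset.range (n + 1), ((i.factorial : ℝ)⁻¹ * iteratedDeriv i g x) * y ^ i‖ₑ ≤
      ENNReal.ofReal (|y| ^ (n + 1)) *
        ∫⁻ t in Set.Ioc (0 : ℝ) 1, ‖iteratedDeriv (n + 1) g (x + t * y)‖ₑ := by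
  have ht := map_add_eq_sum_add_integral_iteratedFDeriv (f := g) (x := x) (y := y) (n := n)
    (fun t _ => by exact_mod_cast hg.contDiffAt)
  simp only [iteratedFDeriv_apply_eq_iteratedDeriv_mul_prod, Finset.prod_const, Finset.card_univ,
    Fintype.card_fin, smul_eq_mul] at ht
  have hsum : ∑ i ∈ Finset.range (n + 1), ((i.factorial : ℝ)⁻¹ * iteratedDeriv i g x) * y ^ i =
      ∑ i ∈ Finset.range (n + 1), (i.factorial : ℝ)⁻¹ * (y ^ i * iteratedDeriv i g x) :=
    Finset.sum_congr rfl fun i _ => by ring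
  rw [ht, hsum, add_sub_cancel_left, intervalIntegral.integral_of_le zero_le_one,
    ← lintegral_const_mul' _ _ ENNReal.ofReal_ne_top, enorm_mul]
  have hfac : ‖((n.factorial : ℝ)⁻¹)‖ₑ ≤ 1 := by
    rw [Real.enorm_eq_ofReal (by positivity), ← ENNReal.ofReal_one]
    refine ENNReal.ofReal_le_ofReal (inv_le_one_of_one_le₀ ?_)
    exact_mod_cast n.factorial_pos
  refine (mul_le_of_le_one_left' hfac).trans ((enorm_integral_le_lintegral_enorm _).trans ?_)
  refine setLIntegral_mono_ae' measurableSet_Ioc (.of_forall fun t ht => ?_)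
  rw [enorm_mul, enorm_mul, Real.enorm_eq_ofReal_abs (y ^ _), abs_pow]
  refine mul_le_of_le_one_left' ?_
  rw [Real.enorm_eq_ofReal_abs, ← ENNReal.ofReal_one, abs_pow]
  refine ENNReal.ofReal_le_ofReal (pow_le_one₀ (abs_nonneg _) ?_)
  rw [abs_le]
  exact ⟨by linarith [ht.2], by linarith [ht.1]⟩

/-- The operator reproduces the Taylor polynomial of `g` at `x`, so that only the Taylor remainder
contributes to the error at `x`. -/
theorem enorm_durrmeyerOp_one_sub_le {φ ψ : ℝ → ℝ} {n : ℕ} {K C θ p : ℝ} (hp : 1 ≤ p)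
    (hθ : ((n + 1 : ℕ) : ℝ) + 1 < θ)
    (hφ0 : ∀ u, discreteMoment φ 0 u = 1) (hφ : ∀ u, |φ u| ≤ C * (1 + |u|) ^ (-θ))
    (hψ : AEStronglyMeasurable ψ volume)
    {B : ℝ} (hB : ∀ u, |ψ u| ≤ B) (hs : HasCompactSupport ψ) (hψ0 : continuousMoment ψ 0 = 1)
    (hv : VanishingMoments φ ψ (n + 1)) (hK0 : 0 ≤ K)
    (hK : KernelBound φ ψ K θ)
    {g : ℝ → ℝ} (hg : ContDiff ℝ (n + 1 : ℕ) g) (hgp : MemLp g (ENNReal.ofReal p) volume) (x : ℝ) :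
    ‖durrmeyerOp φ ψ 1 g x - g x‖ₑ ≤
      ∫⁻ y, ENNReal.ofReal (K * (1 + |y|) ^ (-θ)) * (ENNReal.ofReal (|y| ^ (n + 1)) *
        ∫⁻ t in Set.Ioc (0 : ℝ) 1, ‖iteratedDeriv (n + 1) g (x + t * y)‖ₑ) := by
  set c : ℕ → ℝ := fun i => (i.factorial : ℝ)⁻¹ * iteratedDeriv i g x with hc
  -- The Taylor polynomial of `g` at `x`, and the remainder.
  set P : ℝ → ℝ := fun u => ∑ i ∈ Finset.range (n + 1), c i * (u - x) ^ i with hP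
  set R : ℝ → ℝ := fun u => g u - P u with hR
  have hPc : Continuous P := by fun_prop
  have hθ1 : 1 < θ := by
    have : (0 : ℝ) ≤ ((n + 1 : ℕ) : ℝ) := by positivity
    linarith
  have hintpow (k : ℤ) (i : ℕ) : Integrable (fun u => ψ (u - k) * (u - x) ^ i) volume :=
    integrable_translate_mul hψ hB hs
      (by fun_prop : Continuous fun u : ℝ => (u - x) ^ i).locallyIntegrable k
  have hcoeffP (k : ℤ) : coeff ψ 1 P k =
      ∑ i ∈ Finset.range (n + 1), c i * coeff ψ 1 (fun u => (u - x) ^ i) k := by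
    simp_rw [coeff_one, ← integral_const_mul]
    rw [← integral_finsetSum _ fun i _ => (hintpow k i).const_mul _]
    refine integral_congr_ae (.of_forall fun u => ?_)
    simp only [hP, Finset.mul_sum]
    exact Finset.sum_congr rfl fun i _ => by ring
  have hsumP : HasSum (fun k : ℤ => φ (x - k) * coeff ψ 1 P k) (g x) := by
    have h1 : HasSum (fun k : ℤ => ∑ i ∈ Finset.range (n + 1),
        c i * (φ (x - k) * coeff ψ 1 (fun u => (u - x) ^ i) k))
        (∑ i ∈ Finset.range (n + 1), c i * (if i = 0 then 1 else 0)) :=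
      hasSum_sum fun i hi => (hasSum_mul_coeff_one_sub_pow hθ hφ0 hφ hψ hB hs hψ0 hv x
        (Finset.mem_range.mp hi)).mul_left _
    have h2 : ∑ i ∈ Finset.range (n + 1), c i * (if i = 0 then 1 else 0) = g x := by
      simp [hc]
    rw [h2] at h1
    convert h1 using 2 with k
    rw [hcoeffP, Finset.mul_sum]
    exact Finset.sum_congr rfl fun i _ => by ring
  have hsumR := (summable_mul_coeff hp hθ1 hψ hK0 hK hgp x).hasSum.sub hsumP
  have hcoeffR (k : ℤ) : φ (x - k) * coeff ψ 1 g k - φ (x - k) * coeff ψ 1 P k =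
      φ (x - k) * coeff ψ 1 R k := by
    rw [← mul_sub, coeff_one, coeff_one, coeff_one, ← integral_sub
      (integrable_translate_mul hψ hB hs hg.continuous.locallyIntegrable _)
      (integrable_translate_mul hψ hB hs hPc.locallyIntegrable _)]
    simp_rw [hR, mul_sub]
  simp_rw [hcoeffR] at hsumR
  rw [durrmeyerOp_one, ← hsumR.tsum_eq]
  refine enorm_tsum_le_tsum_enorm.trans ((tsum_enorm_mul_coeff_le hψ hK
    (hg.continuous.sub hPc).aestronglyMeasurable x).trans ?_)
  gcongr with y
  simpa [hR, hP] using enorm_taylor_remainder_le hg x y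

/-- Minkowski's inequality for the measure with density `K (1 + |y|)^(-θ) |y|^(n + 1)` in `y`, times
the uniform measure in `t ∈ (0, 1]`; its total mass is finite because `θ > n + 2`. -/
theorem exists_eLpNorm_durrmeyerOp_one_sub_le {φ ψ : ℝ → ℝ} {n : ℕ} {K C θ p : ℝ} (hp : 1 ≤ p)
    (hθ : ((n + 1 : ℕ) : ℝ) + 1 < θ)
    (hφ0 : ∀ u, discreteMoment φ 0 u = 1) (hφ : ∀ u, |φ u| ≤ C * (1 + |u|) ^ (-θ))
    (hψ : AEStronglyMeasurable ψ volume)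
    {B : ℝ} (hB : ∀ u, |ψ u| ≤ B) (hs : HasCompactSupport ψ) (hψ0 : continuousMoment ψ 0 = 1)
    (hv : VanishingMoments φ ψ (n + 1)) (hK0 : 0 ≤ K)
    (hK : KernelBound φ ψ K θ) :
    ∃ D : ℝ≥0∞, D < ∞ ∧ ∀ g : ℝ → ℝ, ContDiff ℝ (n + 1 : ℕ) g →
      MemLp g (ENNReal.ofReal p) volume →
      eLpNorm (fun x => durrmeyerOp φ ψ 1 g x - g x) (ENNReal.ofReal p) volume ≤
        D * eLpNorm (iteratedDeriv (n + 1) g) (ENNReal.ofReal p) volume := by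
  set κ : ℝ → ℝ≥0∞ := fun y =>
    ENNReal.ofReal (K * (1 + |y|) ^ (-θ)) * ENNReal.ofReal (|y| ^ (n + 1)) with hκ
  have hκm : Measurable κ := by fun_prop
  have hκ_lt : ∫⁻ y, κ y < ∞ := by
    refine (lintegral_mono fun y => ?_).trans_lt
      (lintegral_one_add_abs_rpow_lt_top K (s := θ - (n + 1 : ℕ)) (by linarith))
    have h0 : 0 < 1 + |y| := by positivity
    simp only [hκ]
    rw [← ENNReal.ofReal_mul (by positivity), neg_sub', sub_neg_eq_add, Real.rpow_add h0,
      Real.rpow_natCast, ← mul_assoc]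
    refine ENNReal.ofReal_le_ofReal ?_
    gcongr
    linarith
  have hfin : IsFiniteMeasure (volume.withDensity κ) :=
    isFiniteMeasure_withDensity hκ_lt.ne
  set τ : Measure ℝ := volume.restrict (Set.Ioc 0 1) with hτ
  have hτfin : IsFiniteMeasure τ := ⟨by simp [hτ]⟩
  refine ⟨(volume.withDensity κ).prod τ Set.univ, measure_lt_top _ _, fun g hg hgp => ?_⟩
  have hGc : Continuous (iteratedDeriv (n + 1) g) := hg.continuous_iteratedDeriv _ le_rfl
  refine eLpNorm_le_of_enorm_le_lintegral (μ := volume) hp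
    (F := fun x z => iteratedDeriv (n + 1) g (x + z.2 * z.1)) ?_ (fun x => ?_) ?_
  · refine Continuous.aestronglyMeasurable ?_
    unfold Function.uncurry
    fun_prop
  · refine (enorm_durrmeyerOp_one_sub_le hp hθ hφ0 hφ hψ hB hs hψ0 hv hK0 hK hg hgp x).trans_eq ?_
    rw [lintegral_prod _ (by fun_prop), lintegral_withDensity_eq_lintegral_mul_non_measurable _ hκm
      (.of_forall fun y => ENNReal.mul_lt_top ENNReal.ofReal_lt_top ENNReal.ofReal_lt_top)]
    simp only [hκ, hτ, Pi.mul_apply, mul_assoc]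
  · exact .of_forall fun z => (eLpNorm_comp_measurePreserving hGc.aestronglyMeasurable
      (measurePreserving_add_right volume (z.2 * z.1))).le

/-! ### The modulus of smoothness -/

theorem eLpNorm_finiteDiff_le_modulus {r : ℕ} {p : ℝ≥0∞} (f : ℝ → ℝ) {t δ : ℝ} (ht : |t| ≤ δ) :
    eLpNorm (finiteDiff r t f) p volume ≤ modulus r p f δ :=
  le_iSup₂ (f := fun (t : ℝ) (_ : |t| ≤ δ) => eLpNorm (finiteDiff r t f) p volume) t ht

theorem finiteDiff_sub (r : ℕ) (t : ℝ) (f g : ℝ → ℝ) :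
    finiteDiff r t (f - g) = finiteDiff r t f - finiteDiff r t g := by
  ext x
  simp [finiteDiff, mul_sub]

theorem aestronglyMeasurable_finiteDiff (r : ℕ) (t : ℝ) {f : ℝ → ℝ}
    (hf : AEStronglyMeasurable f volume) : AEStronglyMeasurable (finiteDiff r t f) volume := by
  have h (j : ℕ) : AEStronglyMeasurable
      (fun x => (r.choose j : ℝ) * (-1) ^ (r - j) * f (x + j * t)) volume :=
    (hf.comp_measurePreserving (measurePreserving_add_right volume ((j : ℝ) * t))).const_mul _
  unfold finiteDiff
  fun_prop

theorem eLpNorm_finiteDiff_le (r : ℕ) (t : ℝ) {p : ℝ≥0∞} (hp : 1 ≤ p) {f : ℝ → ℝ}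
    (hf : AEStronglyMeasurable f volume) :
    eLpNorm (finiteDiff r t f) p volume ≤ 2 ^ r * eLpNorm f p volume := by
  have hf' (j : ℕ) := hf.comp_measurePreserving (measurePreserving_add_right volume ((j : ℝ) * t))
  have h : finiteDiff r t f = ∑ j ∈ Finset.range (r + 1),
      ((r.choose j : ℝ) * (-1) ^ (r - j)) • (f ∘ fun x => x + j * t) := by
    ext x
    simp [finiteDiff]
  rw [h]
  refine (eLpNorm_sum_le (fun j _ => (hf' j).const_smul _) hp).trans_eq ?_
  rw [← Nat.cast_two, ← Nat.cast_pow, ← Nat.sum_range_choose, Nat.cast_sum, Finset.sum_mul]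
  refine Finset.sum_congr rfl fun j _ => ?_
  rw [eLpNorm_const_smul, eLpNorm_comp_measurePreserving hf
    (measurePreserving_add_right volume ((j : ℝ) * t)), enorm_mul, enorm_pow, enorm_neg]
  simp [Real.enorm_natCast]

theorem modulus_le_add (r : ℕ) (δ : ℝ) {p : ℝ≥0∞} (hp : 1 ≤ p) {f g : ℝ → ℝ}
    (hf : AEStronglyMeasurable f volume) (hg : AEStronglyMeasurable g volume) :
    modulus r p g δ ≤ modulus r p f δ + 2 ^ r * eLpNorm (f - g) p volume := by
  refine iSup₂_le fun t ht => ?_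
  have h : finiteDiff r t g = finiteDiff r t f - finiteDiff r t (f - g) := by
    rw [finiteDiff_sub, sub_sub_cancel]
  rw [h]
  refine (eLpNorm_sub_le (aestronglyMeasurable_finiteDiff r t hf)
    (aestronglyMeasurable_finiteDiff r t (hf.sub hg)) hp).trans ?_
  gcongr
  · exact eLpNorm_finiteDiff_le_modulus f ht
  · exact eLpNorm_finiteDiff_le r t hp (hf.sub hg)

/-! ### Smooth approximation controlled by the modulus -/

/-- A `C^r` approximation of `f`: the combination of `r`-fold Steklov averages of steps `i / r`,
`1 ≤ i ≤ r` (with `i = j + 1` below), whose coefficients are those of `(-1)^r Δ^r` with the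
term `f(x)` removed and the sign reversed. Averaging `(-1)^r Δ^r_{s/r} f(x)` over `s` thus gives
`f` minus this function. -/
noncomputable def steklovApprox (r : ℕ) (f : ℝ → ℝ) (x : ℝ) : ℝ :=
  ∑ j ∈ Finset.range r, ((-1) ^ j * (r.choose (j + 1) : ℝ)) * steklov r ((j + 1) / r) f x

theorem contDiff_steklovApprox {r : ℕ} (hr : 0 < r) {f : ℝ → ℝ} (hf : Continuous f)
    {C : ℝ} (hC : ∀ x, |f x| ≤ C) : ContDiff ℝ r (steklovApprox r f) := by
  have hs (j : ℕ) : ContDiff ℝ r (steklov r ((j + 1) / r) f) :=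
    (contDiff_steklov_and_iteratedDeriv (by positivity) hf hC r).1
  unfold steklovApprox
  fun_prop

theorem iteratedDeriv_steklovApprox {r : ℕ} (hr : 0 < r) {f : ℝ → ℝ} (hf : Continuous f)
    {C : ℝ} (hC : ∀ x, |f x| ≤ C) :
    iteratedDeriv r (steklovApprox r f) = ∑ j ∈ Finset.range r,
      ((-1) ^ j * (r.choose (j + 1) : ℝ) * (((j : ℝ) + 1) / r)⁻¹ ^ r) •
        finiteDiff r ((j + 1) / r) f := by
  have hs (j : ℕ) := contDiff_steklov_and_iteratedDeriv (h := ((j : ℝ) + 1) / r)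
    (by positivity) hf hC r
  ext x
  unfold steklovApprox
  rw [iteratedDeriv_fun_sum fun j _ => (contDiff_const.mul (hs j).1).contDiffAt, Finset.sum_apply]
  refine Finset.sum_congr rfl fun j _ => ?_
  rw [iteratedDeriv_const_mul_field, (hs j).2]
  simp [fwdDiff_iterate_eq_finiteDiff, mul_assoc]

theorem exists_eLpNorm_iteratedDeriv_steklovApprox_le {r : ℕ} (hr : 0 < r) {p : ℝ≥0∞}
    (hp : 1 ≤ p) :
    ∃ D : ℝ≥0∞, D < ∞ ∧ ∀ f : ℝ → ℝ, Continuous f → (∃ C, ∀ x, |f x| ≤ C) →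
      eLpNorm (iteratedDeriv r (steklovApprox r f)) p volume ≤ D * modulus r p f 1 := by
  refine ⟨∑ j ∈ Finset.range r,
    ‖(-1) ^ j * (r.choose (j + 1) : ℝ) * (((j : ℝ) + 1) / r)⁻¹ ^ r‖ₑ,
    ENNReal.sum_lt_top.mpr fun j _ => enorm_lt_top, fun f hf ⟨C, hC⟩ => ?_⟩
  rw [iteratedDeriv_steklovApprox hr hf hC, Finset.sum_mul]
  refine (eLpNorm_sum_le (fun j _ =>
    (aestronglyMeasurable_finiteDiff r _ hf.aestronglyMeasurable).const_smul _) hp).trans ?_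
  refine Finset.sum_le_sum fun j hj => ?_
  rw [eLpNorm_const_smul]
  gcongr
  refine eLpNorm_finiteDiff_le_modulus f ?_
  have : (j : ℝ) + 1 ≤ r := by exact_mod_cast Finset.mem_range.mp hj
  rw [abs_of_nonneg (by positivity)]
  exact div_le_one_of_le₀ this (by positivity)

theorem sub_steklovApprox_eq_integral (r : ℕ) {f : ℝ → ℝ} (hf : Continuous f)
    {C : ℝ} (hC : ∀ x, |f x| ≤ C) (x : ℝ) :
    f x - steklovApprox r f x =
      ∫ s, (-1) ^ r * finiteDiff r (s / r) f x ∂steklovMeasure r := by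
  have hpt (s : ℝ) : (-1) ^ r * finiteDiff r (s / r) f x = f x -
      ∑ j ∈ Finset.range r,
        ((-1) ^ j * (r.choose (j + 1) : ℝ)) * f (x + ((j : ℝ) + 1) / r * s) := by
    rw [finiteDiff, Finset.sum_range_succ', mul_add, Finset.mul_sum, add_comm, sub_eq_add_neg,
      ← Finset.sum_neg_distrib]
    congr 1
    · simp [← mul_assoc, ← mul_pow]
    · refine Finset.sum_congr rfl fun j hj => ?_
      have hj' : j + 1 ≤ r := Finset.mem_range.mp hj
      have hsign : (-1 : ℝ) ^ r * (-1) ^ (r - (j + 1)) = -(-1) ^ j := by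
        obtain ⟨m, rfl⟩ := Nat.exists_eq_add_of_le hj'
        rw [Nat.add_sub_cancel_left, pow_add, mul_assoc, ← mul_pow]
        simp [pow_succ]
      have harg : x + ((j + 1 : ℕ) : ℝ) * (s / r) = x + ((j : ℝ) + 1) / r * s := by
        push_cast
        ring
      rw [harg]
      linear_combination (r.choose (j + 1) : ℝ) * f (x + ((j : ℝ) + 1) / r * s) * hsign
  have hint (j : ℕ) : Integrable (fun s => f (x + ((j : ℝ) + 1) / r * s)) (steklovMeasure r) :=
    integrable_comp_affine hf hC _ x _
  simp_rw [hpt]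
  rw [integral_sub (integrable_const _) (integrable_finsetSum _ fun j _ => (hint j).const_mul _),
    integral_finsetSum _ fun j _ => (hint j).const_mul _]
  simp_rw [integral_const_mul]
  simp [steklovApprox, steklov]

theorem eLpNorm_sub_steklovApprox_le {r : ℕ} {p : ℝ} (hp : 1 ≤ p) {f : ℝ → ℝ}
    (hf : Continuous f) {C : ℝ} (hC : ∀ x, |f x| ≤ C) :
    eLpNorm (f - steklovApprox r f) (ENNReal.ofReal p) volume ≤
      modulus r (ENNReal.ofReal p) f 1 := by
  have h := eLpNorm_le_of_enorm_le_lintegral (μ := volume) (ν := steklovMeasure r) hp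
    (h := f - steklovApprox r f) (F := fun x s => (-1) ^ r * finiteDiff r (s / r) f x)
    (M := modulus r (ENNReal.ofReal p) f 1) ?_ (fun x => ?_) ?_
  · simpa using h
  · refine Continuous.aestronglyMeasurable ?_
    unfold Function.uncurry finiteDiff
    fun_prop
  · rw [Pi.sub_apply, sub_steklovApprox_eq_integral r hf hC]
    exact enorm_integral_le_lintegral_enorm _
  · filter_upwards [ae_steklovMeasure_mem_Icc r] with s hs
    refine (eLpNorm_const_smul (((-1 : ℝ)) ^ r) (finiteDiff r (s / r) f) _ _).le.trans ?_
    rw [enorm_pow, enorm_neg]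
    simp only [enorm_one, one_pow, one_mul]
    refine eLpNorm_finiteDiff_le_modulus f ?_
    rw [abs_of_nonneg (div_nonneg hs.1 (by positivity))]
    exact div_le_one_of_le₀ hs.2 (by positivity)

/-! ### Linearity and dilation -/

theorem durrmeyerOp_one_sub {φ ψ f g : ℝ → ℝ}
    (hf : ∀ k : ℤ, Integrable (fun u => ψ (u - k) * f u) volume)
    (hg : ∀ k : ℤ, Integrable (fun u => ψ (u - k) * g u) volume)
    (hfs : ∀ x : ℝ, Summable fun k : ℤ => φ (x - k) * coeff ψ 1 f k)
    (hgs : ∀ x : ℝ, Summable fun k : ℤ => φ (x - k) * coeff ψ 1 g k) :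
    durrmeyerOp φ ψ 1 (f - g) = durrmeyerOp φ ψ 1 f - durrmeyerOp φ ψ 1 g := by
  ext x
  rw [Pi.sub_apply, durrmeyerOp_one, durrmeyerOp_one, durrmeyerOp_one,
    ← (hfs x).tsum_sub (hgs x)]
  refine tsum_congr fun k => ?_
  rw [← mul_sub, coeff_one, coeff_one, coeff_one, ← integral_sub (hf k) (hg k)]
  simp_rw [Pi.sub_apply, mul_sub]

theorem finiteDiff_comp_div (r : ℕ) (t : ℝ) (f : ℝ → ℝ) {w : ℝ} (hw : w ≠ 0) (x : ℝ) :
    finiteDiff r t (fun u => f (u / w)) (w * x) = finiteDiff r (t / w) f x := by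
  unfold finiteDiff
  refine Finset.sum_congr rfl fun j _ => ?_
  congr 2
  field_simp

theorem coeff_one_comp_div (ψ f : ℝ → ℝ) {w : ℝ} (hw : 0 < w) (k : ℤ) :
    coeff ψ 1 (fun u => f (u / w)) k = coeff ψ w f k := by
  have h := Measure.integral_comp_mul_left (fun u => ψ (u - k) * f (u / w)) w
  rw [coeff_one, coeff]
  simp only [mul_div_cancel_left₀ _ hw.ne', smul_eq_mul] at h
  rw [h, abs_of_pos (inv_pos.mpr hw), mul_inv_cancel_left₀ hw.ne']

/-- Dilation by `w` reduces the operator to the case `w = 1`. -/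
theorem durrmeyerOp_one_comp_div (φ ψ f : ℝ → ℝ) {w : ℝ} (hw : 0 < w) (x : ℝ) :
    durrmeyerOp φ ψ 1 (fun u => f (u / w)) (w * x) = durrmeyerOp φ ψ w f x := by
  simp_rw [durrmeyerOp_one, coeff_one_comp_div ψ f hw, durrmeyerOp]

theorem eLpNorm_comp_mul_left {p : ℝ≥0∞} (hp : p ≠ ∞) {w : ℝ} (hw : 0 < w) (g : ℝ → ℝ) :
    eLpNorm (fun x => g (w * x)) p volume =
      ENNReal.ofReal w⁻¹ ^ (1 / p).toReal * eLpNorm g p volume := by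
  have hemb : MeasurableEmbedding fun x : ℝ => w * x :=
    (Homeomorph.mulLeft₀ w hw.ne').measurableEmbedding
  have h := hemb.eLpNorm_map_measure (μ := volume) (g := g) (p := p)
  rw [Real.map_volume_mul_left hw.ne', abs_of_pos (inv_pos.mpr hw),
    eLpNorm_smul_measure_of_ne_top hp] at h
  exact h.symm

theorem memLp_comp_mul_left {p : ℝ≥0∞} (hp : p ≠ ∞) {w : ℝ} (hw : 0 < w) {g : ℝ → ℝ}
    (hg : MemLp g p volume) : MemLp (fun x => g (w * x)) p volume := by
  refine ⟨hg.1.comp_quasiMeasurePreserving (Measure.quasiMeasurePreserving_smul volume hw.ne'), ?_⟩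
  rw [eLpNorm_comp_mul_left hp hw]
  exact ENNReal.mul_lt_top (by finiteness) hg.2

/-! ### The error estimate -/

/-- The estimate for `w = 1`. -/
theorem exists_eLpNorm_durrmeyerOp_one_sub_le_modulus {φ ψ : ℝ → ℝ} {n : ℕ} {K C θ p : ℝ}
    (hp : 1 ≤ p) (hθ : ((n + 1 : ℕ) : ℝ) + 1 < θ)
    (hφ0 : ∀ u, discreteMoment φ 0 u = 1) (hφ : ∀ u, |φ u| ≤ C * (1 + |u|) ^ (-θ))
    (hφm : AEStronglyMeasurable φ volume) (hψ : AEStronglyMeasurable ψ volume)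
    {B : ℝ} (hB : ∀ u, |ψ u| ≤ B) (hs : HasCompactSupport ψ) (hψ0 : continuousMoment ψ 0 = 1)
    (hv : VanishingMoments φ ψ (n + 1)) (hK0 : 0 ≤ K) (hK : KernelBound φ ψ K θ) :
    ∃ Λ : ℝ≥0∞, Λ < ∞ ∧ ∀ f : ℝ → ℝ, MemLp f (ENNReal.ofReal p) volume →
      eLpNorm (durrmeyerOp φ ψ 1 f - f) (ENNReal.ofReal p) volume ≤
        Λ * modulus (n + 1) (ENNReal.ofReal p) f 1 := by
  have hp' : 1 ≤ ENNReal.ofReal p := by simpa using hp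
  have hθ1 : 1 < θ := by
    have : (0 : ℝ) ≤ ((n + 1 : ℕ) : ℝ) := by positivity
    linarith
  set T := durrmeyerOp φ ψ 1 with hT
  have hTm (f : ℝ → ℝ) : AEStronglyMeasurable (T f) volume :=
    aestronglyMeasurable_durrmeyerOp_one hφm ψ f
  set A := ∫⁻ y : ℝ, ENNReal.ofReal (K * (1 + |y|) ^ (-θ)) with hA
  have hA_lt : A < ∞ := lintegral_one_add_abs_rpow_lt_top K hθ1
  have hTle {f : ℝ → ℝ} (hf : AEStronglyMeasurable f volume) :
      eLpNorm (T f) (ENNReal.ofReal p) volume ≤ A * eLpNorm f (ENNReal.ofReal p) volume :=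
    eLpNorm_durrmeyerOp_one_le hp hθ1 hψ hK hf
  have hTsub {f g : ℝ → ℝ} (hf : MemLp f (ENNReal.ofReal p) volume)
      (hg : MemLp g (ENNReal.ofReal p) volume) : T (f - g) = T f - T g :=
    durrmeyerOp_one_sub
      (fun k => integrable_translate_mul hψ hB hs (hf.locallyIntegrable hp') k)
      (fun k => integrable_translate_mul hψ hB hs (hg.locallyIntegrable hp') k)
      (summable_mul_coeff hp hθ1 hψ hK0 hK hf) (summable_mul_coeff hp hθ1 hψ hK0 hK hg)
  obtain ⟨D, hD_lt, hD⟩ :=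
    exists_eLpNorm_durrmeyerOp_one_sub_le hp hθ hφ0 hφ hψ hB hs hψ0 hv hK0 hK
  obtain ⟨E, hE_lt, hE⟩ := exists_eLpNorm_iteratedDeriv_steklovApprox_le n.succ_pos hp'
  set Λ := A + D * E + 1 with hΛ
  have hΛ_lt : Λ < ∞ := by
    simp only [hΛ, ENNReal.add_lt_top, ENNReal.one_lt_top, and_true]
    exact ⟨hA_lt, ENNReal.mul_lt_top hD_lt hE_lt⟩
  -- For continuous `f` of compact support, compare with the smooth function `steklovApprox f`.
  have hcont (f : ℝ → ℝ) (hf : Continuous f) (hfs : HasCompactSupport f)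
      (hfp : MemLp f (ENNReal.ofReal p) volume) :
      eLpNorm (T f - f) (ENNReal.ofReal p) volume ≤
        Λ * modulus (n + 1) (ENNReal.ofReal p) f 1 := by
    obtain ⟨M, hM⟩ := hfs.exists_bound_of_continuous hf
    set ω := modulus (n + 1) (ENNReal.ofReal p) f 1 with hω
    have hω_lt : ω < ∞ := by
      refine (iSup₂_le fun t _ => eLpNorm_finiteDiff_le (n + 1) t hp' hfp.1).trans_lt ?_
      exact ENNReal.mul_lt_top (by finiteness) hfp.2
    set g := steklovApprox (n + 1) f with hg
    have hgc : ContDiff ℝ (n + 1 : ℕ) g := contDiff_steklovApprox n.succ_pos hf hM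
    have hfg : eLpNorm (f - g) (ENNReal.ofReal p) volume ≤ ω :=
      eLpNorm_sub_steklovApprox_le hp hf hM
    have hfgp : MemLp (f - g) (ENNReal.ofReal p) volume :=
      ⟨(hf.sub hgc.continuous).aestronglyMeasurable, hfg.trans_lt hω_lt⟩
    have hgp : MemLp g (ENNReal.ofReal p) volume := by
      simpa using hfp.sub hfgp
    have hTg : eLpNorm (T g - g) (ENNReal.ofReal p) volume ≤ D * (E * ω) :=
      (hD g hgc hgp).trans (by gcongr; exact hE f hf ⟨M, hM⟩)
    have hsplit : T f - f = T (f - g) + (T g - g) - (f - g) := by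
      rw [hTsub hfp hgp]
      abel
    calc eLpNorm (T f - f) (ENNReal.ofReal p) volume
        ≤ eLpNorm (T (f - g)) (ENNReal.ofReal p) volume
            + eLpNorm (T g - g) (ENNReal.ofReal p) volume
            + eLpNorm (f - g) (ENNReal.ofReal p) volume := by
          rw [hsplit]
          refine (eLpNorm_sub_le ((hTm _).add ((hTm _).sub hgp.1)) hfgp.1 hp').trans ?_
          gcongr
          exact eLpNorm_add_le (hTm _) ((hTm _).sub hgp.1) hp'
      _ ≤ A * ω + D * (E * ω) + ω := by
          gcongr
          exact (hTle hfgp.1).trans (by gcongr)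
      _ = Λ * ω := by rw [hΛ]; ring
  refine ⟨Λ, hΛ_lt, fun f hf => ?_⟩
  -- In general, approximate by such functions within `ε`; the error terms add up to `c * ε`.
  set c : ℝ≥0∞ := A + Λ * 2 ^ (n + 1) + 1 with hc
  have hc_lt : c < ∞ := by
    simp only [hc, ENNReal.add_lt_top, ENNReal.one_lt_top, and_true]
    exact ⟨hA_lt, ENNReal.mul_lt_top hΛ_lt (by finiteness)⟩
  have happrox (ε : ℝ≥0∞) (hε : ε ≠ 0) : eLpNorm (T f - f) (ENNReal.ofReal p) volume ≤
      Λ * modulus (n + 1) (ENNReal.ofReal p) f 1 + c * ε := by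
    obtain ⟨g, hgs, hfg, hgc, hgp⟩ :=
      hf.exists_hasCompactSupport_eLpNorm_sub_le ENNReal.ofReal_ne_top hε
    have hsplit : T f - f = T (f - g) + (T g - g) - (f - g) := by
      rw [hTsub hf hgp]
      abel
    calc eLpNorm (T f - f) (ENNReal.ofReal p) volume
        ≤ eLpNorm (T (f - g)) (ENNReal.ofReal p) volume
            + eLpNorm (T g - g) (ENNReal.ofReal p) volume
            + eLpNorm (f - g) (ENNReal.ofReal p) volume := by
          rw [hsplit]
          refine (eLpNorm_sub_le ((hTm _).add ((hTm _).sub hgp.1)) (hf.sub hgp).1 hp').trans ?_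
          gcongr
          exact eLpNorm_add_le (hTm _) ((hTm _).sub hgp.1) hp'
      _ ≤ A * ε + Λ * (modulus (n + 1) (ENNReal.ofReal p) f 1 + 2 ^ (n + 1) * ε) + ε := by
          gcongr
          · exact (hTle (hf.sub hgp).1).trans (by gcongr)
          · refine (hcont g hgc hgs hgp).trans ?_
            gcongr
            exact (modulus_le_add (n + 1) 1 hp' hf.1 hgp.1).trans (by gcongr)
      _ = _ := by rw [hc]; ring
  refine ENNReal.le_of_forall_pos_le_add fun ε hε _ => ?_
  have hc0 : c ≠ 0 := by simp [hc]
  refine (happrox (ε / c) (ENNReal.div_ne_zero.mpr ⟨by exact_mod_cast hε.ne', hc_lt.ne⟩)).trans ?_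
  rw [ENNReal.mul_div_cancel hc0 hc_lt.ne]

end Durrmeyer

theorem mainTheorem3 (p : ℝ) (hp : 1 ≤ p) (r : ℕ) (hr : 1 < r) (φ ψ : ℝ → ℝ)
    (hφ : Durrmeyer.IsDiscreteKernel φ) (hψ : Durrmeyer.IsContinuousKernel ψ)
    (h_const : Durrmeyer.ConstantMoments φ r)
    (h_vanish : Durrmeyer.VanishingMoments φ ψ r)
    (θ : ℝ) (hθ : p * r + 1 < θ) (h_decay : Durrmeyer.DecayCondition φ θ)
    (h_supp : HasCompactSupport ψ)
    (h_mom : Durrmeyer.absDiscreteMoment ψ 0 < ∞) :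
    ∃ Λ : ℝ, 0 < Λ ∧
      ∀ f : ℝ → ℝ, MemLp f (ENNReal.ofReal p) volume → ∀ w : ℝ, 0 < w →
        (∀ k : ℤ, Integrable (fun u : ℝ => ψ (w * u - k) * f u) volume) ∧
        (∀ x : ℝ, Summable fun k : ℤ => φ (w * x - k) * Durrmeyer.coeff ψ w f k) ∧
        MemLp (Durrmeyer.durrmeyerOp φ ψ w f) (ENNReal.ofReal p) volume ∧
        eLpNorm (fun x : ℝ => Durrmeyer.durrmeyerOp φ ψ w f x - f x)
            (ENNReal.ofReal p) volume ≤
          ENNReal.ofReal Λ * Durrmeyer.modulus r (ENNReal.ofReal p) f (1 / w) := by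
  have hp0 : 0 < p := by linarith
  have hp' : 1 ≤ ENNReal.ofReal p := by simpa using hp
  obtain ⟨n, rfl⟩ : ∃ n, r = n + 1 := ⟨r - 1, by omega⟩
  have hθ' : ((n + 1 : ℕ) : ℝ) + 1 < θ := by
    have : (0 : ℝ) ≤ ((n + 1 : ℕ) : ℝ) := by positivity
    nlinarith
  have hθ1 : 1 < θ := by
    have : (0 : ℝ) ≤ ((n + 1 : ℕ) : ℝ) := by positivity
    linarith
  have hθ0 : 0 < θ := by linarith
  have hψm := hψ.integrable.aestronglyMeasurable
  have hB := Durrmeyer.abs_le_of_absDiscreteMoment_zero_lt_top h_mom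
  obtain ⟨C, hC0, hC⟩ := Durrmeyer.exists_abs_le_one_add_abs_rpow hθ0 hφ.bounded h_decay
  obtain ⟨K, hK0, hK⟩ := Durrmeyer.exists_kernelBound hC0 hθ0 hC h_supp h_mom
  obtain ⟨Λ, hΛ_lt, hΛ⟩ := Durrmeyer.exists_eLpNorm_durrmeyerOp_one_sub_le_modulus hp hθ'
    hφ.moment_zero hC hφ.integrable.aestronglyMeasurable hψm hB h_supp hψ.moment_zero h_vanish
    hK0 hK
  refine ⟨Λ.toReal + 1, by positivity, fun f hf w hw => ?_⟩
  set q := ENNReal.ofReal p with hq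
  set F : ℝ → ℝ := fun u => f (u / w) with hF
  set T := Durrmeyer.durrmeyerOp φ ψ 1 with hT
  have hFf : (fun x => F (w * x)) = f := by
    ext x
    simp [hF, mul_div_cancel_left₀ _ hw.ne']
  have hop : Durrmeyer.durrmeyerOp φ ψ w f = fun x => T F (w * x) :=
    funext fun x => (Durrmeyer.durrmeyerOp_one_comp_div φ ψ f hw x).symm
  have hFp : MemLp F q volume := by
    have h1 : F = fun u => f (w⁻¹ * u) := by
      ext u
      simp [hF, div_eq_inv_mul]
    rw [h1]
    exact Durrmeyer.memLp_comp_mul_left ENNReal.ofReal_ne_top (inv_pos.mpr hw) hf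
  set s : ℝ≥0∞ := ENNReal.ofReal w⁻¹ ^ (1 / q).toReal with hs
  have hscale (g : ℝ → ℝ) : eLpNorm (fun x => g (w * x)) q volume = s * eLpNorm g q volume :=
    Durrmeyer.eLpNorm_comp_mul_left ENNReal.ofReal_ne_top hw g
  have hmain : eLpNorm (fun x : ℝ => Durrmeyer.durrmeyerOp φ ψ w f x - f x) q volume ≤
      ENNReal.ofReal (Λ.toReal + 1) * Durrmeyer.modulus (n + 1) q f (1 / w) := by
    have h1 : (fun x : ℝ => Durrmeyer.durrmeyerOp φ ψ w f x - f x) =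
        fun x => (T F - F) (w * x) := by
      rw [hop]
      conv_lhs => rw [← hFf]
      rfl
    have h2 : s * Durrmeyer.modulus (n + 1) q F 1 ≤ Durrmeyer.modulus (n + 1) q f (1 / w) := by
      unfold Durrmeyer.modulus
      simp_rw [ENNReal.mul_iSup]
      refine iSup₂_le fun t ht => ?_
      rw [← hscale]
      simp_rw [hF, Durrmeyer.finiteDiff_comp_div (n + 1) t f hw.ne']
      refine Durrmeyer.eLpNorm_finiteDiff_le_modulus f ?_
      rw [abs_div, abs_of_pos hw]
      gcongr
    have h3 : Λ ≤ ENNReal.ofReal (Λ.toReal + 1) := by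
      rw [← ENNReal.ofReal_toReal hΛ_lt.ne, ENNReal.toReal_ofReal ENNReal.toReal_nonneg]
      exact ENNReal.ofReal_le_ofReal (by linarith)
    calc eLpNorm (fun x : ℝ => Durrmeyer.durrmeyerOp φ ψ w f x - f x) q volume
        = s * eLpNorm (T F - F) q volume := by rw [h1, hscale]
      _ ≤ s * (Λ * Durrmeyer.modulus (n + 1) q F 1) := by
          gcongr
          exact hΛ F hFp
      _ = Λ * (s * Durrmeyer.modulus (n + 1) q F 1) := by ring
      _ ≤ _ := by gcongr
  refine ⟨fun k => ?_, fun x => ?_, ?_, hmain⟩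
  · have h1 := Durrmeyer.integrable_translate_mul hψm hB h_supp (hFp.locallyIntegrable hp') k
    have h2 := h1.comp_mul_left' hw.ne'
    refine h2.congr (.of_forall fun u => ?_)
    simp [hF, mul_div_cancel_left₀ _ hw.ne']
  · have h1 := Durrmeyer.summable_mul_coeff hp hθ1 hψm hK0 hK hFp (w * x)
    simpa only [hF, Durrmeyer.coeff_one_comp_div ψ f hw] using h1
  · rw [hop]
    refine Durrmeyer.memLp_comp_mul_left ENNReal.ofReal_ne_top hw
      ⟨Durrmeyer.aestronglyMeasurable_durrmeyerOp_one hφ.integrable.aestronglyMeasurable ψ F, ?_⟩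
    exact (Durrmeyer.eLpNorm_durrmeyerOp_one_le hp hθ1 hψm hK hFp.1).trans_lt
      (ENNReal.mul_lt_top (Durrmeyer.lintegral_one_add_abs_rpow_lt_top K hθ1) hFp.2)
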